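/- An influence graph $G=(V,E,(p_{uv})_{(u,v)\in E})$ is a finite directed graph with activation probabilities $p_{uv}\in[0,1]$. Its live-edge graph $L$ is the random subgraph that contains each edge $(u,v)\in E$ independently with probability $p_{uv}$. For $S\subseteq V$ let $R(S,L)$ be the set of nodes reachable in $L$ from a node of $S$, and let $\sigma(S)=\mathbb{E}_L[|R(S,L)|]$. Let $OPT_N(G,k)$ be the maximum of $\sigma(S)$ over the sets $S\subseteq V$ with $|S|=k$. An adaptive policy $\pi$ (with full-adoption feedback) selects seeds one at a time: given the partial realisation observed so far, i.e. the family of pairs $(v,R(\{v\},L))$ for the seeds $v$ selected so far, it deterministically returns the next seed or stops. We write $|\pi|=k$ if, on every live-edge graph, it stops after having selected exactly $k$ distinct seeds. Its value $\sigma(\pi)$ is the expected number of nodes reachable in $L$ from the selected seeds, and $OPT_A(G,k)$ is the maximum of $\sigma(\pi)$ over the policies with $|\pi|=k$. For a class $\mathcal{G}$ of influence graphs, the $k$-adaptivity gap is $$AG(\mathcal{G},k)=\sup_{G\in\mathcal{G},\ |V(G)|\ge k}\frac{OPT_A(G,k)}{OPT_N(G,k)}.$$ An influence graph is $0$-bounded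 if its edge set consists of the two orientations $(u,v),(v,u)$ of every edge of an undirected simple graph in which no node has degree higher than $2$ (that is, every connected component is a path, possibly a single node, or a cycle); the probabilities $p_{uv}$ and $p_{vu}$ may be distinct. **Theorem.** Let $\mathcal{G}$ be the class of $0$-bounded influence graphs. Then, for every integer $k\ge 2$, $$AG(\mathcal{G},k)\le\min\left\{k,\ \frac{3}{1-\left(\max\{0,1-3/k\}\right)^k}\right\}\le\frac{3e^3}{e^3-1}\approx 3.16,$$ where $\approx$ means that the two numbers differ by less than $0.005$. -/

import Mathlib

universe u

/-- An influence graph on the node set `V`: a set of directed edges `(u, v)`, each with an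
activation probability `prob u v ∈ [0, 1]`. (Values of `prob` off the edges are never used.) -/
structure InfluenceGraph (V : Type u) where
  Adj : V → V → Prop
  prob : V → V → ℝ
  prob_mem : ∀ u v, Adj u v → prob u v ∈ Set.Icc (0 : ℝ) 1

/-- A partial realisation: a partial function assigning to some nodes `v` (the selected seeds)
the set of nodes activated by `v`; `none` means that `v` is not in the domain. -/
abbrev PartialRealisation (V : Type u) : Type u := V → Option (Finset V)

/-- A (deterministic) adaptive policy: given the partial realisation observed so far, it returns
the next seed node, or `none`, which stands for STOP. -/
abbrev AdaptivePolicy (V : Type u) : Type u := PartialRealisation V → Option V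

namespace InfluenceGraph

variable {V : Type u} [Fintype V]

open Classical in
/-- The finite set of directed edges. -/
noncomputable def edges (G : InfluenceGraph V) : Finset (V × V) :=
  Finset.univ.filter fun e => G.Adj e.1 e.2

open Classical in
/-- The probability that the set of live edges is exactly `L ⊆ E`, when each edge `e` is live
with probability `p e`, independently of the other edges. -/
noncomputable def liveProb (G : InfluenceGraph V) (L : Finset (V × V)) : ℝ :=
  (∏ e ∈ L, G.prob e.1 e.2) * ∏ e ∈ G.edges \ L, (1 - G.prob e.1 e.2)

/-- The expectation of `X L` over the random live-edge graph `L`. -/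
noncomputable def expect (G : InfluenceGraph V) (X : Finset (V × V) → ℝ) : ℝ :=
  ∑ L ∈ G.edges.powerset, G.liveProb L * X L

end InfluenceGraph

section Diffusion

variable {V : Type u} [Fintype V]

open Classical in
/-- `R(S, L)`: the nodes reachable from `S` by a (possibly trivial) directed path in `L`. -/
noncomputable def reach (S : Finset V) (L : Finset (V × V)) : Finset V :=
  Finset.univ.filter fun v => ∃ u ∈ S, Relation.ReflTransGen (fun a b => (a, b) ∈ L) u v

open Classical in
/-- The domain of a partial realisation. -/
noncomputable def PartialRealisation.dom (ψ : PartialRealisation V) : Finset V :=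
  Finset.univ.filter fun v => ψ v ≠ none

open Classical in
/-- `R(ψ)`: the set of nodes activated by the seeds in the domain of `ψ`. -/
noncomputable def PartialRealisation.activated (ψ : PartialRealisation V) : Finset V :=
  Finset.univ.filter fun w => ∃ v A, ψ v = some A ∧ w ∈ A

namespace AdaptivePolicy

open Classical in
/-- One pass of the adaptive algorithm on the live-edge graph `L`: if the policy says STOP then
nothing changes, and if it selects `v` then `(v, R({v}, L))` is added to the partial realisation. -/
noncomputable def step (π : AdaptivePolicy V) (L : Finset (V × V)) (ψ : PartialRealisation V) :
    PartialRealisation V :=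
  match π ψ with
  | none => ψ
  | some v => Function.update ψ v (some (reach {v} L))

/-- The partial realisation returned by the adaptive algorithm on `L`, started at the empty partial
realisation. A pass that does not stop either enlarges the domain or changes nothing (and then
the algorithm never stops), so if the algorithm stops at all, it does so within `|V|` passes. -/
noncomputable def run (π : AdaptivePolicy V) (L : Finset (V × V)) : PartialRealisation V :=
  (π.step L)^[Fintype.card V] (fun _ => none)

end AdaptivePolicy

end Diffusion

namespace InfluenceGraph

variable {V : Type u} [Fintype V]

/-- `σ(S)`: the expected influence spread of a seed set. -/
noncomputable def spread (G : InfluenceGraph V) (S : Finset V) : ℝ :=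
  G.expect fun L => ((reach S L).card : ℝ)

/-- `|π| = k`: on every live-edge graph the algorithm stops, with exactly `k` seeds selected. -/
def PolicySize (G : InfluenceGraph V) (π : AdaptivePolicy V) (k : ℕ) : Prop :=
  ∀ L ⊆ G.edges, π (π.run L) = none ∧ (PartialRealisation.dom (π.run L)).card = k

/-- `σ(π)`: the expected influence spread of an adaptive policy. -/
noncomputable def policySpread (G : InfluenceGraph V) (π : AdaptivePolicy V) : ℝ :=
  G.expect fun L => ((PartialRealisation.activated (π.run L)).card : ℝ)

/-- The optimal value of the non-adaptive problem (a maximum over finitely many seed sets,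
nonempty when `k ≤ |V|`). -/
noncomputable def optN (G : InfluenceGraph V) (k : ℕ) : ℝ :=
  sSup (G.spread '' {S | S.card = k})

/-- The optimal value of the adaptive problem (a maximum over finitely many policies,
nonempty when `k ≤ |V|`). -/
noncomputable def optA (G : InfluenceGraph V) (k : ℕ) : ℝ :=
  sSup (G.policySpread '' {π | G.PolicySize π k})

open Classical in
/-- `α`-bounded influence graphs: the edges are the two orientations of the edges of an undirected
simple graph (the two probabilities may differ) in which the node degrees that are
higher than two sum to at most `α`. -/
def IsBounded (α : ℕ) (G : InfluenceGraph V) : Prop :=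
  ∃ H : SimpleGraph V, (∀ u v, G.Adj u v ↔ H.Adj u v) ∧
    (∑ v ∈ Finset.univ.filter (fun v => 2 < H.degree v), H.degree v) ≤ α

end InfluenceGraph

/-- The `k`-adaptivity gap of a class of finite influence graphs: the supremum, in the extended
reals, of `OPT_A(G, k) / OPT_N(G, k)` over the graphs `G` of the class for which `k` distinct seeds
can be chosen. -/
noncomputable def adaptivityGap
    (C : ∀ (V : Type u) [Fintype V], Set (InfluenceGraph V)) (k : ℕ) : EReal :=
  ⨆ (V : Type u) (_ : Fintype V) (G : InfluenceGraph V) (_ : G ∈ C V)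
    (_ : k ≤ Fintype.card V), ((G.optA k / G.optN k : ℝ) : EReal)

/-- The class of `α`-bounded influence graphs. -/
def boundedClass (α : ℕ) (V : Type u) [Fintype V] : Set (InfluenceGraph V) :=
  {G | G.IsBounded α}

/-! Fix a policy `π` with `k` seeds and let `x v` be the probability that it selects `v`, so that
the `x v` sum to `k`. The non-adaptive competitor draws `k` seeds independently, each equal to `v`
with probability `x v / k`. If D is the random set of nodes that can reach m, the draw misses m with
conditional probability (1 - x(D)/k)^k ≤ exp(-x(D)). Hence the non-adaptive optimum is at least the
sum over m of ρ(m) = E[1 - exp(-x(D))] (`sum_expect_le_optN`), and it suffices to show, node by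
node, that the policy activates m with probability at most 3 ρ(m)
(`probability_activated_le_three_mul`).

Let C be the component of m. If x(C) ≤ 2, a union bound suffices: a new seed v knows nothing about
the edges outside the activated set, so m is activated with probability at most E[x(D)]
(`probability_activated_le`), and 1 - exp(-t) ≥ 3t/7 on [0, 2]. Summed over m, the same union bound
gives the factor `k`.

If x(C) ≥ 2, D is the union of the live segments of two arms that leave m in opposite directions. On
one arm, the policy picks from the live segment, before m is active, with probability at most twice
the probability that Poisson seeds with rates `x` hit it; this is an induction along the arm
(`probability_picksFrom_tail_le`). The arms use different directed edges, even when both run around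
a cycle, so they are independent and their bounds multiply. The segments overlap away from m only if
all of C reaches m, and then D is missed with probability at most exp(-2). The two cases give the
factors 7/3 and 8/3, both below 3. -/

namespace InfluenceGraph

/-! ### Expectation, probability and independence for live-edge graphs. -/

variable {V : Type u} [Fintype V] (G : InfluenceGraph V)

theorem prob_mem_of_mem_edges {e : V × V} (he : e ∈ G.edges) :
    G.prob e.1 e.2 ∈ Set.Icc (0 : ℝ) 1 :=
  G.prob_mem _ _ (by simpa [edges] using he)

theorem liveProb_nonneg {L : Finset (V × V)} (hL : L ⊆ G.edges) : 0 ≤ G.liveProb L := by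
  classical
  unfold liveProb
  refine mul_nonneg (Finset.prod_nonneg fun e he => (G.prob_mem_of_mem_edges (hL he)).1)
    (Finset.prod_nonneg fun e he => ?_)
  have := (G.prob_mem_of_mem_edges (Finset.mem_sdiff.1 he).1).2
  linarith

theorem expect_mono {X Y : Finset (V × V) → ℝ} (h : ∀ L ⊆ G.edges, X L ≤ Y L) :
    G.expect X ≤ G.expect Y :=
  Finset.sum_le_sum fun L hL =>
    mul_le_mul_of_nonneg_left (h L (Finset.mem_powerset.1 hL))
      (G.liveProb_nonneg (Finset.mem_powerset.1 hL))

theorem expect_congr {X Y : Finset (V × V) → ℝ} (h : ∀ L ⊆ G.edges, X L = Y L) :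
    G.expect X = G.expect Y :=
  Finset.sum_congr rfl fun L hL => by rw [h L (Finset.mem_powerset.1 hL)]

theorem expect_add (X Y : Finset (V × V) → ℝ) :
    G.expect (fun L => X L + Y L) = G.expect X + G.expect Y := by
  simp [expect, mul_add, Finset.sum_add_distrib]

theorem expect_const_mul (c : ℝ) (X : Finset (V × V) → ℝ) :
    G.expect (fun L => c * X L) = c * G.expect X := by
  simp only [expect, Finset.mul_sum]
  exact Finset.sum_congr rfl fun _ _ => by ring

theorem expect_sub (X Y : Finset (V × V) → ℝ) :
    G.expect (fun L => X L - Y L) = G.expect X - G.expect Y := by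
  simp [expect, mul_sub, Finset.sum_sub_distrib]

theorem expect_sum {ι : Type*} (s : Finset ι) (X : ι → Finset (V × V) → ℝ) :
    G.expect (fun L => ∑ i ∈ s, X i L) = ∑ i ∈ s, G.expect (X i) := by
  simp only [expect, Finset.mul_sum]
  exact Finset.sum_comm

theorem sum_powerset_prod_eq_one {α : Type*} [DecidableEq α] (s : Finset α) (p : α → ℝ) :
    ∑ t ∈ s.powerset, (∏ e ∈ t, p e) * ∏ e ∈ s \ t, (1 - p e) = 1 := by
  rw [← Finset.prod_add]
  simp

/-- Fubini for the product measure on subsets of `s`, split along `t`. All independence arguments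
rest on it. -/
theorem sum_powerset_split {α : Type*} [DecidableEq α] (s t : Finset α) (p : α → ℝ)
    (f : Finset α → ℝ) :
    ∑ L ∈ s.powerset, ((∏ e ∈ L, p e) * ∏ e ∈ s \ L, (1 - p e)) * f L =
      ∑ A ∈ (s ∩ t).powerset, ((∏ e ∈ A, p e) * ∏ e ∈ (s ∩ t) \ A, (1 - p e)) *
        ∑ B ∈ (s \ t).powerset, ((∏ e ∈ B, p e) * ∏ e ∈ (s \ t) \ B, (1 - p e)) *
          f (A ∪ B) := by
  simp only [Finset.mul_sum]
  rw [← Finset.sum_product']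
  refine (Finset.sum_nbij' (fun x : Finset α × Finset α => x.1 ∪ x.2)
    (fun L => (L ∩ t, L \ t)) ?_ ?_ ?_ ?_ ?_).symm
  · rintro ⟨A, B⟩ h
    simp only [Finset.mem_product, Finset.mem_powerset] at h ⊢
    intro e; grind
  · intro L h
    simp only [Finset.mem_product, Finset.mem_powerset] at h ⊢
    constructor <;> intro e <;> grind
  · rintro ⟨A, B⟩ h
    simp only [Finset.mem_product, Finset.mem_powerset] at h ⊢
    obtain ⟨h1, h2⟩ := h
    refine Prod.ext ?_ ?_ <;> ext e <;> have := @h1 e <;> have := @h2 e <;> grind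
  · intro L h
    simp
    ext e; grind
  · rintro ⟨A, B⟩ h
    simp only [Finset.mem_product, Finset.mem_powerset] at h ⊢
    obtain ⟨h1, h2⟩ := h
    have d1 : Disjoint A B := by
      rw [Finset.disjoint_left]; intro e; have := @h1 e; have := @h2 e; grind
    have d2 : Disjoint ((s ∩ t) \ A) ((s \ t) \ B) := by
      rw [Finset.disjoint_left]; intro e; grind
    have e1 : s \ (A ∪ B) = ((s ∩ t) \ A) ∪ ((s \ t) \ B) := by
      ext e; have := @h1 e; have := @h2 e; grind
    rw [Finset.prod_union d1, e1, Finset.prod_union d2]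
    ring

theorem expect_const (c : ℝ) : G.expect (fun _ => c) = c := by
  classical
  have := sum_powerset_prod_eq_one G.edges (fun e => G.prob e.1 e.2)
  simp only [expect, liveProb, ← Finset.sum_mul]
  convert one_mul c

theorem expect_mul_of_indep [DecidableEq V] (T : Finset (V × V)) {X Y : Finset (V × V) → ℝ}
    (hX : ∀ L ⊆ G.edges, X L = X (L ∩ T)) (hY : ∀ L ⊆ G.edges, Y L = Y (L \ T)) :
    G.expect (fun L => X L * Y L) = G.expect X * G.expect Y := by
  have key : ∀ f : Finset (V × V) → ℝ, G.expect f =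
      ∑ A ∈ (G.edges ∩ T).powerset,
        ((∏ e ∈ A, G.prob e.1 e.2) * ∏ e ∈ (G.edges ∩ T) \ A, (1 - G.prob e.1 e.2)) *
        ∑ B ∈ (G.edges \ T).powerset,
          ((∏ e ∈ B, G.prob e.1 e.2) * ∏ e ∈ (G.edges \ T) \ B, (1 - G.prob e.1 e.2)) *
            f (A ∪ B) := fun f => by
    have := sum_powerset_split G.edges T (fun e => G.prob e.1 e.2) f
    unfold expect liveProb
    convert this
  have hu : ∀ A ∈ (G.edges ∩ T).powerset, ∀ B ∈ (G.edges \ T).powerset,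
      X (A ∪ B) = X A ∧ Y (A ∪ B) = Y B := by
    intro A hA B hB
    rw [Finset.mem_powerset] at hA hB
    have h1 : A ∪ B ⊆ G.edges := by intro e; have := @hA e; have := @hB e; grind
    rw [hX _ h1, hY _ h1]
    constructor <;> congr 1 <;> ext e <;> have := @hA e <;> have := @hB e <;> grind
  have e1 := sum_powerset_prod_eq_one (G.edges ∩ T) (fun e => G.prob e.1 e.2)
  have e2 := sum_powerset_prod_eq_one (G.edges \ T) (fun e => G.prob e.1 e.2)
  have kX : G.expect X = ∑ A ∈ (G.edges ∩ T).powerset,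
      ((∏ e ∈ A, G.prob e.1 e.2) * ∏ e ∈ (G.edges ∩ T) \ A, (1 - G.prob e.1 e.2)) * X A := by
    rw [key]
    refine Finset.sum_congr rfl fun A hA => ?_
    rw [Finset.sum_congr rfl fun B hB => by rw [(hu A hA B hB).1], ← Finset.sum_mul, e2, one_mul]
  have kY : G.expect Y = ∑ B ∈ (G.edges \ T).powerset,
      ((∏ e ∈ B, G.prob e.1 e.2) * ∏ e ∈ (G.edges \ T) \ B, (1 - G.prob e.1 e.2)) * Y B := by
    rw [key, Finset.sum_congr rfl fun A hA => by
      rw [Finset.sum_congr rfl fun B hB => by rw [(hu A hA B hB).2]], ← Finset.sum_mul, e1,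
      one_mul]
  rw [key, kX, kY, Finset.sum_mul]
  refine Finset.sum_congr rfl fun A hA => ?_
  rw [mul_assoc _ (X A)]
  congr 1
  rw [Finset.mul_sum]
  refine Finset.sum_congr rfl fun B hB => ?_
  rw [(hu A hA B hB).1, (hu A hA B hB).2]
  ring

theorem expect_nonneg {X : Finset (V × V) → ℝ} (h : ∀ L ⊆ G.edges, 0 ≤ X L) :
    0 ≤ G.expect X := by
  rw [← G.expect_const 0]
  exact G.expect_mono h

open Classical in
/-- The probability of an event depending on the live-edge graph. -/
noncomputable def probability (P : Finset (V × V) → Prop) : ℝ :=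
  G.expect fun L => if P L then 1 else 0

theorem probability_nonneg (P : Finset (V × V) → Prop) : 0 ≤ G.probability P := by
  have := G.expect_mono (X := fun _ => 0) (Y := fun L => open Classical in if P L then 1 else 0)
    (fun L _ => by split_ifs <;> norm_num)
  rwa [expect_const] at this

theorem probability_le_one (P : Finset (V × V) → Prop) : G.probability P ≤ 1 := by
  have := G.expect_mono (Y := fun _ => 1) (X := fun L => open Classical in if P L then 1 else 0)
    (fun L _ => by split_ifs <;> norm_num)
  rwa [expect_const] at this

theorem probability_mono {P Q : Finset (V × V) → Prop} (h : ∀ L ⊆ G.edges, P L → Q L) :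
    G.probability P ≤ G.probability Q :=
  G.expect_mono fun L hL => by
    by_cases hP : P L
    · simp [hP, h L hL hP]
    · simp only [hP, if_false]; split_ifs <;> norm_num

theorem probability_or_le (P Q : Finset (V × V) → Prop) :
    G.probability (fun L => P L ∨ Q L) ≤ G.probability P + G.probability Q := by
  unfold probability
  rw [← expect_add]
  refine G.expect_mono fun L _ => ?_
  by_cases hP : P L <;> by_cases hQ : Q L <;> simp [hP, hQ]

theorem probability_and_of_indep [DecidableEq V] (T : Finset (V × V))
    {P Q : Finset (V × V) → Prop}
    (hP : ∀ L ⊆ G.edges, (P L ↔ P (L ∩ T))) (hQ : ∀ L ⊆ G.edges, (Q L ↔ Q (L \ T))) :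
    G.probability (fun L => P L ∧ Q L) = G.probability P * G.probability Q := by
  classical
  unfold probability
  rw [← G.expect_mul_of_indep T]
  · refine G.expect_congr fun L _ => ?_
    by_cases h1 : P L <;> by_cases h2 : Q L <;> simp [h1, h2]
  · intro L hL; simp only [hP L hL]
  · intro L hL; simp only [hQ L hL]

theorem probability_mem {e : V × V} (he : e ∈ G.edges) :
    G.probability (fun L => e ∈ L) = G.prob e.1 e.2 := by
  classical
  have h := sum_powerset_split G.edges {e} (fun e => G.prob e.1 e.2)
    (fun L => if e ∈ L then 1 else 0)
  have h1 : G.edges ∩ {e} = {e} := by ext; simp; rintro rfl; exact he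
  have h2 : ∀ B ∈ (G.edges \ {e}).powerset, e ∉ B := by
    intro B hB hh
    have := Finset.mem_powerset.1 hB hh
    simp at this
  have h3 := sum_powerset_prod_eq_one (G.edges \ {e}) (fun e => G.prob e.1 e.2)
  have h4 : ∑ B ∈ (G.edges \ {e}).powerset,
      ((∏ e ∈ B, G.prob e.1 e.2) * ∏ e ∈ (G.edges \ {e}) \ B, (1 - G.prob e.1 e.2)) *
        (if e ∈ ∅ ∪ B then 1 else 0) = 0 :=
    Finset.sum_eq_zero fun B hB => by simp [h2 B hB]
  rw [h1, show ({e} : Finset (V × V)).powerset = {∅, {e}} from by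
      ext; simp [Finset.subset_singleton_iff],
    Finset.sum_pair (Finset.singleton_ne_empty e).symm, h4] at h
  simp only [Finset.mem_union, Finset.mem_singleton, true_or, if_true, mul_one, h3] at h
  simp at h
  unfold probability expect liveProb
  convert h using 2
  simp

theorem probability_eq_sum_fiber {β : Type*} [Fintype β] (P : Finset (V × V) → Prop)
    (f : Finset (V × V) → β) :
    G.probability P = ∑ b, G.probability fun L => P L ∧ f L = b := by
  classical
  unfold probability
  rw [← expect_sum]
  refine G.expect_congr fun L _ => ?_
  by_cases hP : P L <;> simp [hP]

end InfluenceGraph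

/-! ### What a run reveals, and the union bound over seeds. -/

section Runs

variable {V : Type u}

/-- `w` is reachable from `v` along live edges. -/
def Reaches (L : Finset (V × V)) (v w : V) : Prop :=
  Relation.ReflTransGen (fun a b => (a, b) ∈ L) v w

theorem Reaches.mono {L L' : Finset (V × V)} (h : L ⊆ L') {v w : V} (hr : Reaches L v w) :
    Reaches L' v w :=
  Relation.ReflTransGen.mono (fun _ _ hab => h hab) _ _ hr

/-- Only nodes lying on some live path from `v` to `w` are required to be in `A`, so the lemma
serves both for sets closed under reachability and for their complements. -/
theorem reaches_of_agree {L L' : Finset (V × V)} {A : Set V} {v w : V}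
    (hA : ∀ x, Reaches L v x → Reaches L x w → x ∈ A)
    (h : ∀ e : V × V, e.1 ∈ A → e ∈ L → e ∈ L') (hr : Reaches L v w) : Reaches L' v w := by
  induction hr using Relation.ReflTransGen.head_induction_on with
  | refl => exact Relation.ReflTransGen.refl
  | head hab hbc ih =>
    rename_i a b
    refine Relation.ReflTransGen.head (h (a, b) (hA a .refl (.head hab hbc)) hab) (ih ?_)
    exact fun x hx hxw => hA x (.head hab hx) hxw

variable [Fintype V]

theorem mem_reach {S : Finset V} {L : Finset (V × V)} {w : V} :
    w ∈ reach S L ↔ ∃ v ∈ S, Reaches L v w := by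
  simp [reach, Reaches]

theorem mem_reach_singleton {L : Finset (V × V)} {v w : V} :
    w ∈ reach {v} L ↔ Reaches L v w := by
  simp [mem_reach]

namespace AdaptivePolicy

variable (π : AdaptivePolicy V) (L : Finset (V × V))

/-- The partial realisation after `i` passes of the adaptive algorithm. -/
noncomputable def state (i : ℕ) : PartialRealisation V :=
  (π.step L)^[i] (fun _ => none)

theorem state_succ (i : ℕ) : π.state L (i + 1) = π.step L (π.state L i) :=
  Function.iterate_succ_apply' _ _ _

open Classical in
theorem state_succ_of_some {i : ℕ} {v : V} (h : π (π.state L i) = some v) :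
    π.state L (i + 1) = Function.update (π.state L i) v (some (reach {v} L)) := by
  rw [state_succ, step]
  simp only [h]

theorem state_succ_of_none {i : ℕ} (h : π (π.state L i) = none) :
    π.state L (i + 1) = π.state L i := by
  rw [state_succ, step]
  simp only [h]

theorem state_value {i : ℕ} {v : V} {A : Finset V} (h : π.state L i v = some A) :
    A = reach {v} L := by
  classical
  induction i with
  | zero => simp [state] at h
  | succ i ih =>
    cases hπ : π (π.state L i) with
    | none => exact ih (by rwa [state_succ_of_none π L hπ] at h)
    | some w =>
      rw [state_succ_of_some π L hπ] at h
      by_cases hw : v = w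
      · subst hw; simpa using h.symm
      · exact ih (by simpa [Function.update_of_ne hw] using h)

theorem state_ne_none_succ {i : ℕ} {v : V} (h : π.state L i v ≠ none) :
    π.state L (i + 1) v ≠ none := by
  classical
  cases hπ : π (π.state L i) with
  | none => rwa [state_succ_of_none π L hπ]
  | some w =>
    rw [state_succ_of_some π L hπ]
    by_cases hw : v = w
    · subst hw; simp
    · rwa [Function.update_of_ne hw]

theorem state_ne_none_mono {i j : ℕ} (hij : i ≤ j) {v : V} (h : π.state L i v ≠ none) :
    π.state L j v ≠ none := by
  induction j, hij using Nat.le_induction with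
  | base => exact h
  | succ j _ ih => exact π.state_ne_none_succ L ih

theorem mem_activated_state {i : ℕ} {w : V} :
    w ∈ (π.state L i).activated ↔ ∃ v, π.state L i v ≠ none ∧ Reaches L v w := by
  simp only [PartialRealisation.activated, Finset.mem_filter, Finset.mem_univ, true_and]
  constructor
  · rintro ⟨v, A, hv, hw⟩
    refine ⟨v, by simp [hv], ?_⟩
    rw [π.state_value L hv] at hw
    exact mem_reach_singleton.1 hw
  · rintro ⟨v, hv, hw⟩
    obtain ⟨A, hA⟩ := Option.ne_none_iff_exists'.1 hv
    refine ⟨v, A, hA, ?_⟩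
    rw [π.state_value L hA]
    exact mem_reach_singleton.2 hw

theorem activated_closed {i : ℕ} {w z : V} (hw : w ∈ (π.state L i).activated)
    (h : Reaches L w z) : z ∈ (π.state L i).activated := by
  rw [mem_activated_state] at hw ⊢
  obtain ⟨v, hv, hvw⟩ := hw
  exact ⟨v, hv, hvw.trans h⟩

theorem activated_mono {i j : ℕ} (hij : i ≤ j) :
    (π.state L i).activated ⊆ (π.state L j).activated := by
  intro w hw
  rw [mem_activated_state] at hw ⊢
  obtain ⟨v, hv, hvw⟩ := hw
  exact ⟨v, π.state_ne_none_mono L hij hv, hvw⟩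

/-- In pass `i` the algorithm selects `v` as a new seed. -/
def Picks (i : ℕ) (v : V) : Prop :=
  π (π.state L i) = some v ∧ π.state L i v = none

theorem Picks.state_ne_none {i j : ℕ} {v : V} (h : π.Picks L i v) (hij : i < j) :
    π.state L j v ≠ none := by
  classical
  refine π.state_ne_none_mono L hij ?_
  rw [π.state_succ_of_some L h.1]
  simp

theorem Picks.unique {i j : ℕ} {v : V} (hi : π.Picks L i v) (hj : π.Picks L j v) : i = j := by
  rcases lt_trichotomy i j with h | h | h
  · exact absurd hj.2 (hi.state_ne_none π L h)
  · exact h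
  · exact absurd hi.2 (hj.state_ne_none π L h)

theorem exists_picks_of_mem_activated {n : ℕ} {m : V} (h : m ∈ (π.state L n).activated) :
    ∃ i < n, ∃ v, π.Picks L i v ∧ m ∉ (π.state L i).activated ∧ Reaches L v m := by
  classical
  induction n with
  | zero => simp [state, PartialRealisation.activated] at h
  | succ n ih =>
    by_cases hn : m ∈ (π.state L n).activated
    · obtain ⟨i, hi, hh⟩ := ih hn
      exact ⟨i, by omega, hh⟩
    · cases hπ : π (π.state L n) with
      | none => rw [state_succ_of_none π L hπ] at h; exact absurd h hn
      | some v =>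
        obtain ⟨w, hw, hwm⟩ := (π.mem_activated_state L).1 h
        have hwv : w = v := by
          by_contra hne
          rw [state_succ_of_some π L hπ, Function.update_of_ne hne] at hw
          exact hn ((π.mem_activated_state L).2 ⟨w, hw, hwm⟩)
        subst hwv
        refine ⟨n, by omega, w, ⟨hπ, ?_⟩, hn, hwm⟩
        by_contra hne
        exact hn ((π.mem_activated_state L).2 ⟨w, hne, hwm⟩)

/-- Feedback reveals only edges that leave activated nodes. This locality is what makes the
unexplored edges independent of the history. -/
theorem state_congr {L L' : Finset (V × V)} {i : ℕ}
    (h : ∀ e : V × V, e.1 ∈ (π.state L i).activated → (e ∈ L ↔ e ∈ L')) :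
    π.state L i = π.state L' i := by
  classical
  induction i with
  | zero => rfl
  | succ i ih =>
    have ih := ih fun e he => h e (π.activated_mono L i.le_succ he)
    cases hπ : π (π.state L i) with
    | none => rw [π.state_succ_of_none L hπ, π.state_succ_of_none L' (ih ▸ hπ), ih]
    | some v =>
      have hv : ∀ w, Reaches L v w → w ∈ (π.state L (i + 1)).activated := fun w hw => by
        rw [mem_activated_state]
        refine ⟨v, ?_, hw⟩
        rw [state_succ_of_some π L hπ]
        simp
      have hr : reach {v} L = reach {v} L' := by
        ext w
        rw [mem_reach_singleton, mem_reach_singleton]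
        constructor
        · intro hw
          exact reaches_of_agree (A := {x | x ∈ (π.state L (i + 1)).activated})
            (fun x hx _ => hv x hx) (fun e he hL => (h e he).1 hL) hw
        · intro hw
          induction hw with
          | refl => exact .refl
          | tail _ hbc ih => exact .tail ih ((h _ (hv _ ih)).2 hbc)
      rw [π.state_succ_of_some L hπ, π.state_succ_of_some L' (ih ▸ hπ), ih, hr]

theorem state_eq_iff_inter [DecidableEq V] (i : ℕ) (ψ : PartialRealisation V) :
    π.state L i = ψ ↔
      π.state (L ∩ Finset.univ.filter fun e : V × V => e.1 ∈ ψ.activated) i = ψ := by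
  constructor <;> intro h
  · rw [← h]
    refine (π.state_congr fun e he => ?_).symm
    simp [he]
  · conv_rhs => rw [← h]
    refine (π.state_congr fun e he => ?_).symm
    rw [h] at he
    simp [he]

end AdaptivePolicy

namespace InfluenceGraph

variable (G : InfluenceGraph V) (π : AdaptivePolicy V)

/-- The probability that `v` is selected as a seed. -/
noncomputable def seedProb (v : V) : ℝ :=
  G.probability fun L => v ∈ (π.run L).dom

theorem seedProb_nonneg (v : V) : 0 ≤ G.seedProb π v := G.probability_nonneg _

theorem mem_dom_run {L : Finset (V × V)} {v : V} :
    v ∈ (π.run L).dom ↔ π.state L (Fintype.card V) v ≠ none := by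
  rw [PartialRealisation.dom, Finset.mem_filter]
  simp [AdaptivePolicy.run, AdaptivePolicy.state]

theorem sum_seedProb {k : ℕ} (h : G.PolicySize π k) : ∑ v, G.seedProb π v = k := by
  unfold seedProb probability
  rw [← expect_sum, ← G.expect_const k]
  refine G.expect_congr fun L hL => ?_
  rw [Finset.sum_boole, ← (h L hL).2]
  congr 2
  ext; simp

theorem policySpread_eq :
    G.policySpread π = ∑ m, G.probability fun L => m ∈ (π.run L).activated := by
  unfold policySpread probability
  rw [← expect_sum]
  refine G.expect_congr fun L hL => ?_
  rw [Finset.sum_boole]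
  congr 2
  ext; simp

theorem spread_eq (S : Finset V) :
    G.spread S = ∑ m, G.probability fun L => m ∈ reach S L := by
  unfold spread probability
  rw [← expect_sum]
  refine G.expect_congr fun L hL => ?_
  rw [Finset.sum_boole]
  congr 2
  ext; simp

/-- The events for different passes are disjoint, because a node is new only once. -/
theorem sum_probability_picks_le (v : V) :
    ∑ i ∈ Finset.range (Fintype.card V), G.probability (fun L => π.Picks L i v) ≤
      G.seedProb π v := by
  classical
  unfold seedProb probability
  rw [← expect_sum]
  refine G.expect_mono fun L hL => ?_
  rw [Finset.sum_boole]
  by_cases h : ∃ i < Fintype.card V, π.Picks L i v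
  · obtain ⟨i, hi, hp⟩ := h
    rw [if_pos ((mem_dom_run π).2 (hp.state_ne_none π L hi))]
    norm_cast
    refine Finset.card_le_one.2 fun a ha b hb => ?_
    simp only [Finset.mem_filter] at ha hb
    exact ha.2.unique π L hb.2
  · have : (Finset.range (Fintype.card V)).filter (fun i => π.Picks L i v) = ∅ := by
      rw [Finset.filter_eq_empty_iff]
      intro i hi hp
      exact h ⟨i, Finset.mem_range.1 hi, hp⟩
    rw [this]
    simp only [Finset.card_empty, Nat.cast_zero]
    split_ifs <;> norm_num

/-- Condition on the partial realisation ψ. That event depends only on edges leaving the activated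
set. This set is closed under reachability, so a live path to an inactive `m` never enters it and
uses only the remaining, independent edges. -/
theorem probability_picks_reaches_le (i : ℕ) (v m : V) :
    G.probability (fun L => π.Picks L i v ∧ m ∉ (π.state L i).activated ∧ Reaches L v m) ≤
      G.probability (fun L => π.Picks L i v) * G.probability (fun L => Reaches L v m) := by
  classical
  rw [G.probability_eq_sum_fiber _ (fun L => π.state L i),
    G.probability_eq_sum_fiber (fun L => π.Picks L i v) (fun L => π.state L i), Finset.sum_mul]
  refine Finset.sum_le_sum fun ψ _ => ?_
  by_cases hψ : (π ψ = some v ∧ ψ v = none) ∧ m ∉ ψ.activated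
  · set T := Finset.univ.filter fun e : V × V => e.1 ∈ ψ.activated
    calc _ ≤ G.probability (fun L => π.state L i = ψ ∧ Reaches (L \ T) v m) := by
          refine G.probability_mono fun L _ => ?_
          rintro ⟨⟨_, hm, hr⟩, rfl⟩
          refine ⟨rfl, reaches_of_agree (A := {x | x ∉ (π.state L i).activated}) ?_ ?_ hr⟩
          · exact fun x _ hxm hx => hm (π.activated_closed L hx hxm)
          · intro e he hL
            simpa [T, hL] using he
      _ = G.probability (fun L => π.state L i = ψ) *
            G.probability (fun L => Reaches (L \ T) v m) := by
          refine G.probability_and_of_indep T (fun L _ => π.state_eq_iff_inter L i ψ)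
            fun L _ => by simp
      _ ≤ _ := by
          refine mul_le_mul (G.probability_mono fun L _ h => ?_)
            (G.probability_mono fun L _ h => h.mono Finset.sdiff_subset)
            (G.probability_nonneg _) (G.probability_nonneg _)
          subst h
          exact ⟨hψ.1, rfl⟩
  · refine le_trans (le_of_eq ?_)
      (mul_nonneg (G.probability_nonneg _) (G.probability_nonneg _))
    rw [← G.expect_const 0]
    refine G.expect_congr fun L _ => if_neg ?_
    rintro ⟨⟨h1, h2, _⟩, rfl⟩
    exact hψ ⟨h1, h2⟩

theorem probability_exists_le_sum {ι : Type*} (s : Finset ι)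
    (P : ι → Finset (V × V) → Prop) :
    G.probability (fun L => ∃ i ∈ s, P i L) ≤ ∑ i ∈ s, G.probability (P i) := by
  classical
  unfold probability
  rw [← expect_sum]
  refine G.expect_mono fun L _ => ?_
  by_cases h : ∃ i ∈ s, P i L
  · obtain ⟨i, hi, hP⟩ := h
    rw [if_pos ⟨i, hi, hP⟩]
    refine le_trans (by simp [hP]) (Finset.single_le_sum (f := fun i => if P i L then (1 : ℝ) else 0)
      (fun j _ => by split_ifs <;> norm_num) hi)
  · rw [if_neg h]
    exact Finset.sum_nonneg fun j _ => by split_ifs <;> norm_num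

/-- A node is activated with at most the probability that one would get by adding up the
activation probabilities of independent cascades, one for every seed. -/
theorem probability_activated_le (m : V) :
    G.probability (fun L => m ∈ (π.run L).activated) ≤
      ∑ v, G.seedProb π v * G.probability (fun L => Reaches L v m) := by
  -- Charge `m` to the pass that first activates it.
  calc _ ≤ G.probability (fun L => ∃ v ∈ (Finset.univ : Finset V),
        ∃ i ∈ Finset.range (Fintype.card V),
          π.Picks L i v ∧ m ∉ (π.state L i).activated ∧ Reaches L v m) := by
        refine G.probability_mono fun L _ h => ?_
        obtain ⟨i, hi, v, hh⟩ := π.exists_picks_of_mem_activated L h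
        exact ⟨v, Finset.mem_univ _, i, Finset.mem_range.2 hi, hh⟩
    _ ≤ ∑ v, ∑ i ∈ Finset.range (Fintype.card V), G.probability (fun L =>
          π.Picks L i v ∧ m ∉ (π.state L i).activated ∧ Reaches L v m) :=
        (G.probability_exists_le_sum _ _).trans
          (Finset.sum_le_sum fun v _ => G.probability_exists_le_sum _ _)
    _ ≤ _ := by
        refine Finset.sum_le_sum fun v _ => ?_
        refine (Finset.sum_le_sum fun i _ => G.probability_picks_reaches_le π i v m).trans ?_
        rw [← Finset.sum_mul]
        exact mul_le_mul_of_nonneg_right (G.sum_probability_picks_le π v)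
          (G.probability_nonneg _)

end InfluenceGraph

end Runs

/-! ### Paths and cycles: the two arms at a node. -/

section Chains

variable {V : Type u}

open Classical in
/-- The longest initial segment of a list all of whose consecutive pairs `a, b` are joined by a
live edge `(b, a)`. -/
noncomputable def liveSegment (L : Finset (V × V)) : List V → List V
  | [] => []
  | [a] => [a]
  | a :: b :: l => a :: if (b, a) ∈ L then liveSegment L (b :: l) else []

/-- The edges `(b, a)` of consecutive pairs `a, b` of a list. -/
def chainEdges : List V → List (V × V)
  | [] => []
  | [_] => []
  | a :: b :: l => (b, a) :: chainEdges (b :: l)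

theorem mem_chainEdges {l : List V} {e : V × V} :
    e ∈ chainEdges l ↔ ∃ (i : ℕ) (h : i + 1 < l.length), e = (l[i + 1], l[i]) := by
  induction l with
  | nil => simp [chainEdges]
  | cons a l ih =>
    cases l with
    | nil => simp [chainEdges]
    | cons b l =>
      rw [chainEdges, List.mem_cons, ih]
      constructor
      · rintro (rfl | ⟨i, h, rfl⟩)
        · exact ⟨0, by simp, rfl⟩
        · exact ⟨i + 1, by simpa using h, rfl⟩
      · rintro ⟨i, h, rfl⟩
        cases i with
        | zero => left; rfl
        | succ i => right; exact ⟨i, by simpa using h, rfl⟩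

theorem mem_of_mem_chainEdges {l : List V} {e : V × V} (h : e ∈ chainEdges l) :
    e.1 ∈ l ∧ e.2 ∈ l := by
  obtain ⟨i, hi, rfl⟩ := mem_chainEdges.1 h
  exact ⟨List.getElem_mem _, List.getElem_mem _⟩

theorem liveSegment_congr {L L' : Finset (V × V)} {l : List V}
    (h : ∀ e ∈ chainEdges l, (e ∈ L ↔ e ∈ L')) : liveSegment L l = liveSegment L' l := by
  induction l with
  | nil => rfl
  | cons a l ih =>
    cases l with
    | nil => rfl
    | cons b l =>
      simp only [chainEdges, List.mem_cons, forall_eq_or_imp] at h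
      rw [liveSegment, liveSegment, ih h.2]
      by_cases hL : (b, a) ∈ L
      · rw [if_pos hL, if_pos (h.1.1 hL)]
      · rw [if_neg hL, if_neg fun h' => hL (h.1.2 h')]

theorem liveSegment_isPrefix (L : Finset (V × V)) (l : List V) : liveSegment L l <+: l := by
  induction l with
  | nil => simp [liveSegment]
  | cons a l ih =>
    cases l with
    | nil => simp [liveSegment]
    | cons b l =>
      rw [liveSegment]
      split_ifs
      · simpa using ih
      · simp

theorem liveSegment_cons (L : Finset (V × V)) (u : V) (l : List V) :
    liveSegment L (u :: l) = u :: (liveSegment L (u :: l)).tail := by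
  cases l <;> simp [liveSegment]

theorem reaches_of_mem_liveSegment {L : Finset (V × V)} {u v : V} {l : List V}
    (h : v ∈ liveSegment L (u :: l)) : Reaches L v u := by
  induction l generalizing u with
  | nil =>
    simp only [liveSegment, List.mem_singleton] at h
    subst h; exact .refl
  | cons w l ih =>
    rw [liveSegment, List.mem_cons] at h
    rcases h with rfl | h
    · exact .refl
    · split_ifs at h with hL
      · exact .tail (ih h) hL
      · simp at h

/-- Cut the walk at its first visit to `u`; the part before its last edge then avoids `u` as well.
-/
theorem reaches_avoiding_cases {L : Finset (V × V)} {B : Set V} {u v : V}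
    (h : Relation.ReflTransGen (fun a b => (a, b) ∈ L ∧ a ∉ B) v u) :
    v = u ∨ ∃ w, w ∉ insert u B ∧ (w, u) ∈ L ∧
      Relation.ReflTransGen (fun a b => (a, b) ∈ L ∧ a ∉ insert u B) v w := by
  induction h using Relation.ReflTransGen.head_induction_on with
  | refl => exact .inl rfl
  | head hab hbc ih =>
    rename_i a c
    by_cases ha : a = u
    · exact .inl ha
    · right
      have haB : a ∉ insert u B := by simp [ha, hab.2]
      rcases ih with rfl | ⟨w, hw, hwu, hbw⟩
      · exact ⟨a, haB, hab.1, .refl⟩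
      · exact ⟨w, hw, hwu, .head ⟨hab.1, haB⟩ hbw⟩

variable {H : SimpleGraph V}

/-- Every node of the graph has at most two neighbours. -/
def SimpleGraph.AtMostTwoNeighbors (H : SimpleGraph V) : Prop :=
  ∀ ⦃y a b z⦄, H.Adj y a → H.Adj y b → H.Adj y z → a ≠ z → b ≠ z → a = b

/-- Walk away from `u` without entering `B`. Each node has at most one way on, since adding it to
`B` leaves its successor with at most one neighbour outside. The walk is therefore forced, and every
live path to `u` outside `B` must come in along it. -/
theorem exists_chain [Finite V] (hH : H.AtMostTwoNeighbors) (B : Set V) (u : V) (hu : u ∉ B)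
    (hB : ∀ a b, H.Adj u a → H.Adj u b → a ∉ B → b ∉ B → a = b) :
    ∃ l : List V, (u :: l).IsChain H.Adj ∧ (u :: l).Nodup ∧ (∀ w ∈ u :: l, w ∉ B) ∧
      ∀ (L : Finset (V × V)) (v : V), (∀ e ∈ L, H.Adj e.1 e.2) →
        Relation.ReflTransGen (fun a b => (a, b) ∈ L ∧ a ∉ B) v u → v ∈ liveSegment L (u :: l) := by
  induction hn : Bᶜ.ncard using Nat.strong_induction_on generalizing B u with
  | _ n ih =>
  by_cases hw : ∃ w, H.Adj u w ∧ w ∉ B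
  · obtain ⟨w, huw, hwB⟩ := hw
    have hwu : w ∉ insert u B := by simp [hwB, huw.ne']
    obtain ⟨l, h1, h2, h3, h4⟩ := ih (insert u B)ᶜ.ncard (by
        rw [← hn]
        refine Set.ncard_lt_ncard ⟨fun x hx hxB => hx (.inr hxB), fun h => ?_⟩ (Set.toFinite _)
        exact h (show u ∈ Bᶜ from hu) (.inl rfl)) (insert u B) w hwu (by
        intro a b ha hb haB hbB
        exact hH ha hb huw.symm (fun h => haB (.inl h)) (fun h => hbB (.inl h))) rfl
    refine ⟨w :: l, List.isChain_cons_cons.2 ⟨huw, h1⟩, List.nodup_cons.2 ⟨?_, h2⟩, ?_, ?_⟩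
    · exact fun h => h3 u h (.inl rfl)
    · intro y hy
      rcases List.mem_cons.1 hy with rfl | hy
      · exact hu
      · exact fun hyB => h3 y hy (.inr hyB)
    · intro L v hL hv
      rw [liveSegment, List.mem_cons]
      rcases reaches_avoiding_cases hv with rfl | ⟨z, hz, hzu, hvz⟩
      · exact .inl rfl
      · right
        have : z = w := hB z w (hL _ hzu).symm huw (fun h => hz (.inr h)) hwB
        subst this
        rw [if_pos hzu]
        exact h4 L v hL hvz
  · refine ⟨[], by simp, by simp, by simpa using hu, ?_⟩
    intro L v hL hv
    rcases reaches_avoiding_cases hv with rfl | ⟨z, hz, hzu, hvz⟩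
    · simp [liveSegment]
    · exact absurd ⟨z, (hL _ hzu).symm, fun h => hz (.inr h)⟩ hw

/-- Two paths with the same first node, but with different second nodes. -/
structure SimpleGraph.Fork (H : SimpleGraph V) (p q : List V) : Prop where
  chain_left : p.IsChain H.Adj
  chain_right : q.IsChain H.Adj
  nodup_left : p.Nodup
  nodup_right : q.Nodup
  zero_eq : ∀ (h : 0 < p.length) (h' : 0 < q.length), p[0] = q[0]
  one_ne : ∀ (h : 1 < p.length) (h' : 1 < q.length), p[1] ≠ q[1]

namespace SimpleGraph.Fork

variable {p q : List V}

theorem symm (F : H.Fork p q) : H.Fork q p :=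
  ⟨F.chain_right, F.chain_left, F.nodup_right, F.nodup_left, fun h h' => (F.zero_eq h' h).symm,
    fun h h' => (F.one_ne h' h).symm⟩

theorem of_isPrefix (F : H.Fork p q) {s t : List V} (hs : s <+: p) (ht : t <+: q) :
    H.Fork s t := by
  refine ⟨F.chain_left.prefix hs, F.chain_right.prefix ht, F.nodup_left.sublist hs.sublist,
    F.nodup_right.sublist ht.sublist, fun h h' => ?_, fun h h' => ?_⟩
  · rw [hs.getElem h, ht.getElem h']
    exact F.zero_eq _ _
  · rw [hs.getElem h, ht.getElem h']
    exact F.one_ne _ _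

/-- A shared oriented step has a unique predecessor, so it could be traced back along both paths to
the start, where the second nodes differ. On a cycle the two arms may cross the same edge, but only
in opposite orientations. -/
theorem pair_ne (hH : H.AtMostTwoNeighbors) (F : H.Fork p q) {i j : ℕ} (hi : i + 1 < p.length)
    (hj : j + 1 < q.length) (h0 : p[i] = q[j]) : p[i + 1] ≠ q[j + 1] := by
  intro h1
  induction i generalizing j with
  | zero =>
    have : q[j] = q[0] := by rw [← h0]; exact F.zero_eq _ _
    have : j = 0 := (F.nodup_right.getElem_inj_iff).1 this
    subst this
    exact F.one_ne _ _ h1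
  | succ i ih =>
    cases j with
    | zero =>
      have : p[i + 1] = p[0] := by rw [h0]; exact (F.zero_eq _ _).symm
      have := (F.nodup_left.getElem_inj_iff).1 this
      omega
    | succ j =>
      have hc := List.isChain_iff_getElem.1 F.chain_left
      have hd := List.isChain_iff_getElem.1 F.chain_right
      refine ih (j := j) (by omega) (by omega) ?_ h0
      refine hH (hc i (by omega)).symm (h0 ▸ (hd j (by omega)).symm) (hc (i + 1) hi) ?_ ?_
      · intro h
        have := (F.nodup_left.getElem_inj_iff).1 h
        omega
      · rw [h1]
        intro h
        have := (F.nodup_right.getElem_inj_iff).1 h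
        omega

theorem disjoint_chainEdges (hH : H.AtMostTwoNeighbors) (F : H.Fork p q) :
    (chainEdges p).Disjoint (chainEdges q) := by
  intro e hc hd
  obtain ⟨i, hi, rfl⟩ := mem_chainEdges.1 hc
  obtain ⟨j, hj, h⟩ := mem_chainEdges.1 hd
  rw [Prod.mk.injEq] at h
  exact F.pair_ne hH hi hj h.2 h.1

/-- Each node of `p` up to the meeting point already has two neighbours on the paths: its neighbours
in `p` if it is interior, `p[1]` and `q[1]` at the start, `p[i]` and `q[j]` at the meeting point.
There is no third. -/
theorem closed_left (hH : H.AtMostTwoNeighbors) (F : H.Fork p q) {i j : ℕ}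
    (hi : i + 1 < p.length) (hj : j + 1 < q.length) (hij : p[i + 1] = q[j + 1])
    {t : ℕ} (ht : t < p.length) (hti : t ≤ i + 1) {z : V} (hz : H.Adj p[t] z) :
    z ∈ p ∨ z ∈ q := by
  have hc := List.isChain_iff_getElem.1 F.chain_left
  have hd := List.isChain_iff_getElem.1 F.chain_right
  have key : ∀ a b, H.Adj p[t] a → H.Adj p[t] b → a ≠ b → z = a ∨ z = b := by
    intro a b ha hb hab
    by_contra! h
    exact h.2 (hH hz hb ha h.1 hab.symm)
  rcases Nat.eq_zero_or_pos t with rfl | h0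
  · rcases key p[1] q[1] (hc 0 (by omega)) (F.zero_eq (by omega) (by omega) ▸ hd 0 (by omega))
      (F.one_ne _ _) with rfl | rfl
    · exact .inl (List.getElem_mem _)
    · exact .inr (List.getElem_mem _)
  · obtain ⟨s, rfl⟩ := Nat.exists_eq_add_of_lt h0
    simp only [Nat.zero_add] at *
    rcases Nat.lt_or_ge s i with hs | hs
    · rcases key p[s] p[s + 2] (hc s (by omega)).symm (hc (s + 1) (by omega)) (by
        intro h
        have := (F.nodup_left.getElem_inj_iff).1 h
        omega) with rfl | rfl
      · exact .inl (List.getElem_mem _)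
      · exact .inl (List.getElem_mem _)
    · obtain rfl : s = i := by omega
      rcases key p[s] q[j] (hc s (by omega)).symm (hij ▸ (hd j (by omega)).symm) (fun h =>
        F.pair_ne hH hi hj h hij) with rfl | rfl
      · exact .inl (List.getElem_mem _)
      · exact .inr (List.getElem_mem _)

/-- If the two paths of a fork meet again, then they cover a connected component. -/
theorem cover (hH : H.AtMostTwoNeighbors) {m : V} {a b : List V}
    (F : H.Fork (m :: a) (m :: b)) {v : V} (hva : v ∈ a) (hvb : v ∈ b) {y : V}
    (hy : H.Reachable m y) : y ∈ m :: a ∨ y ∈ m :: b := by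
  obtain ⟨i, hi, rfl⟩ := List.mem_iff_getElem.1 hva
  obtain ⟨j, hj, hij⟩ := List.mem_iff_getElem.1 hvb
  -- Truncate both paths at the meeting point, so that `closed_left` applies to every node that is
  -- left.
  have F' := F.of_isPrefix (List.take_prefix (i + 2) _) (List.take_prefix (j + 2) _)
  have hij' : ((m :: a).take (i + 2))[i + 1]'(by simp; omega) =
    ((m :: b).take (j + 2))[j + 1]'(by simp; omega) := by simp [hij]
  suffices h : y ∈ (m :: a).take (i + 2) ∨ y ∈ (m :: b).take (j + 2) from
    h.imp List.mem_of_mem_take List.mem_of_mem_take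
  rw [SimpleGraph.reachable_iff_reflTransGen] at hy
  induction hy with
  | refl => simp
  | tail _ hbc ih =>
    rcases ih with h | h
    · obtain ⟨t, ht, rfl⟩ := List.mem_iff_getElem.1 h
      exact F'.closed_left hH _ _ hij' ht (by simp at ht; omega) hbc
    · obtain ⟨t, ht, rfl⟩ := List.mem_iff_getElem.1 h
      exact (F'.symm.closed_left hH _ _ hij'.symm ht (by simp at ht; omega) hbc).symm

end SimpleGraph.Fork

theorem exists_fork [Finite V] (hH : H.AtMostTwoNeighbors) (m : V) :
    ∃ a b : List V, H.Fork (m :: a) (m :: b) ∧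
      ∀ (L : Finset (V × V)) (v : V), (∀ e ∈ L, H.Adj e.1 e.2) → Reaches L v m →
        v ∈ liveSegment L (m :: a) ∨ v ∈ liveSegment L (m :: b) := by
  have arm : ∀ u, H.Adj m u → ∃ l : List V, (m :: u :: l).IsChain H.Adj ∧ (m :: u :: l).Nodup ∧
      ∀ (L : Finset (V × V)) (v : V), (∀ e ∈ L, H.Adj e.1 e.2) → (u, m) ∈ L →
        Relation.ReflTransGen (fun a b => (a, b) ∈ L ∧ a ∉ ({m} : Set V)) v u →
          v ∈ liveSegment L (m :: u :: l) := by
    intro u hu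
    obtain ⟨l, h1, h2, h3, h4⟩ := exists_chain hH {m} u (by simpa using hu.ne')
      fun a b ha hb ham hbm => hH ha hb hu.symm ham hbm
    refine ⟨l, List.isChain_cons_cons.2 ⟨hu, h1⟩, List.nodup_cons.2 ⟨fun h => h3 m h rfl, h2⟩, ?_⟩
    intro L v hL hum hv
    rw [liveSegment, if_pos hum]
    exact List.mem_cons_of_mem _ (h4 L v hL hv)
  by_cases hu : ∃ u, H.Adj m u
  · obtain ⟨u, hu⟩ := hu
    obtain ⟨l, hl, hl', hlr⟩ := arm u hu
    by_cases hw : ∃ w, H.Adj m w ∧ w ≠ u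
    · obtain ⟨w, hw, hwu⟩ := hw
      obtain ⟨r, hr, hr', hrr⟩ := arm w hw
      refine ⟨u :: l, w :: r, ⟨hl, hr, hl', hr', fun _ _ => rfl, fun _ _ => hwu.symm⟩, ?_⟩
      intro L v hL hv
      rcases reaches_avoiding_cases (B := ∅) (by simpa [Reaches] using hv) with rfl | ⟨z, hz, hzm, hvz⟩
      · rw [liveSegment_cons]; simp
      · rw [insert_empty_eq] at hz hvz
        by_cases hzu : z = u
        · subst hzu; exact .inl (hlr L v hL hzm hvz)
        · obtain rfl : z = w := hH (hL _ hzm).symm hw hu hzu hwu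
          exact .inr (hrr L v hL hzm hvz)
    -- With a single neighbour the second arm is empty and the condition on second nodes is vacuous.
    · refine ⟨u :: l, [], ⟨hl, by simp, hl', by simp, fun _ _ => rfl, fun _ h => by simp at h⟩, ?_⟩
      intro L v hL hv
      rcases reaches_avoiding_cases (B := ∅) (by simpa [Reaches] using hv) with rfl | ⟨z, hz, hzm, hvz⟩
      · rw [liveSegment_cons]; simp
      · rw [insert_empty_eq] at hz hvz
        obtain rfl : z = u := by
          by_contra hne
          exact hw ⟨z, (hL _ hzm).symm, hne⟩
        exact .inl (hlr L v hL hzm hvz)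
  · refine ⟨[], [], ⟨by simp, by simp, by simp, by simp, fun _ _ => rfl, fun h => by simp at h⟩, ?_⟩
    intro L v hL hv
    rcases reaches_avoiding_cases (B := ∅) (by simpa [Reaches] using hv) with rfl | ⟨z, hz, hzm, hvz⟩
    · simp [liveSegment]
    · exact absurd ⟨z, (hL _ hzm).symm⟩ hu

end Chains

/-! ### One arm: a policy against Poisson seeds with the same rates. -/

section PathBound

variable {V : Type u}

/-- The probability that a Poisson process of seeds with rates `x` misses a list of nodes. -/
noncomputable def missProb (x : V → ℝ) (l : List V) : ℝ :=
  Real.exp (-(l.map x).sum)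

theorem missProb_cons (x : V → ℝ) (u : V) (l : List V) :
    missProb x (u :: l) = Real.exp (-x u) * missProb x l := by
  simp [missProb, ← Real.exp_add, add_comm]

theorem missProb_nonneg (x : V → ℝ) (l : List V) : 0 ≤ missProb x l := Real.exp_nonneg _

theorem missProb_nil (x : V → ℝ) : missProb x [] = 1 := by simp [missProb]

/-- The inductive step when a node of rate `x` is put in front of a segment. Since exp(-x) ≤ 1/(1 +
x), the claim reduces to a(1 + x) ≤ 2x + t, which follows from a ≤ x + t if x + t ≤ 1 and from a ≤ 1
otherwise. -/
theorem le_two_sub_two_mul {x t a R : ℝ} (hx : 0 ≤ x) (ht' : t ≤ 1) (ha : a ≤ 1)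
    (hat : a ≤ x + t) (hR : t ≤ 2 - 2 * R) : a ≤ 2 - 2 * (Real.exp (-x) * R) := by
  have h1 : Real.exp (-x) * (1 + x) ≤ 1 := by
    have := Real.add_one_le_exp x
    calc Real.exp (-x) * (1 + x) ≤ Real.exp (-x) * Real.exp x := by
          gcongr; linarith
      _ = 1 := by rw [← Real.exp_add]; simp
  have h0 := Real.exp_pos (-x)
  have h2 : Real.exp (-x) * R ≤ Real.exp (-x) * (1 - t / 2) :=
    mul_le_mul_of_nonneg_left (by linarith) h0.le
  have h3 : Real.exp (-x) * (1 + x) * (2 - t) ≤ 1 * (2 - t) :=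
    mul_le_mul_of_nonneg_right h1 (by linarith)
  have h4 : a * (1 + x) ≤ 2 * x + t := by
    rcases le_total (x + t) 1 with h | h
    · nlinarith
    · nlinarith
  have h5 : (1 + x) * (a + 2 * (Real.exp (-x) * (1 - t / 2))) ≤ (1 + x) * 2 := by nlinarith
  have h6 := le_of_mul_le_mul_left h5 (by linarith)
  linarith

variable [Fintype V]

namespace AdaptivePolicy

variable (π : AdaptivePolicy V)

/-- Some pass selects a new seed on the list `l` at a time when the node `u` is not yet active. -/
def PicksFrom (L : Finset (V × V)) (u : V) (l : List V) : Prop :=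
  ∃ i < Fintype.card V, ∃ v ∈ l, π.Picks L i v ∧ u ∉ (π.state L i).activated

/-- As long as `u` is inactive, the policy has seen nothing of the edges that leave `u`. -/
theorem PicksFrom.of_agree {L L' : Finset (V × V)} {u : V} {l : List V}
    (h : ∀ e : V × V, e.1 ≠ u → (e ∈ L ↔ e ∈ L')) (hp : π.PicksFrom L u l) :
    π.PicksFrom L' u l := by
  obtain ⟨i, hi, v, hv, hpick, hu⟩ := hp
  have hs : π.state L i = π.state L' i :=
    π.state_congr fun e he => h e fun heu => hu (heu ▸ he)
  refine ⟨i, hi, v, hv, ?_, hs ▸ hu⟩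
  unfold Picks at hpick ⊢
  rwa [← hs]

theorem PicksFrom.of_cons {L : Finset (V × V)} {u : V} {l : List V}
    (hp : π.PicksFrom L u (u :: l)) : u ∈ (π.run L).dom ∨ π.PicksFrom L u l := by
  obtain ⟨i, hi, v, hv, hpick, hu⟩ := hp
  rcases List.mem_cons.1 hv with rfl | hv
  · left
    rw [InfluenceGraph.mem_dom_run]
    exact hpick.state_ne_none π L hi
  · exact .inr ⟨i, hi, v, hv, hpick, hu⟩

theorem PicksFrom.of_mem {L : Finset (V × V)} {u w : V} {l : List V} (h : (w, u) ∈ L)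
    (hp : π.PicksFrom L u l) : π.PicksFrom L w l := by
  obtain ⟨i, hi, v, hv, hpick, hu⟩ := hp
  exact ⟨i, hi, v, hv, hpick, fun hw => hu (π.activated_closed L hw (.single h))⟩

end AdaptivePolicy

namespace InfluenceGraph

variable (G : InfluenceGraph V) (π : AdaptivePolicy V)

open Classical in
theorem expect_gate {e : V × V} (he : e ∈ G.edges) {X : Finset (V × V) → ℝ}
    (hX : ∀ L ⊆ G.edges, X L = X (L \ {e})) :
    G.expect (fun L => if e ∈ L then X L else 1) =
      1 - G.prob e.1 e.2 + G.prob e.1 e.2 * G.expect X := by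
  have h := G.expect_mul_of_indep {e} (X := fun L => if e ∈ L then 1 else 0) (Y := X)
    (fun L _ => by simp) hX
  have he : G.expect (fun L => if e ∈ L then (1 : ℝ) else 0) = G.prob e.1 e.2 := by
    rw [← G.probability_mem he, probability]; congr!
  calc _ = G.expect (fun L => 1 - (if e ∈ L then 1 else 0) + (if e ∈ L then 1 else 0) * X L) :=
        G.expect_congr fun L _ => by by_cases h : e ∈ L <;> simp [h]
    _ = _ := by rw [expect_add, expect_sub, expect_const, h, he]

theorem probability_picksFrom_cons_le {u : V} {l : List V}
    (h : G.probability (fun L => π.PicksFrom L u (liveSegment L (u :: l)).tail) ≤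
      2 - 2 * G.expect fun L => missProb (G.seedProb π) (liveSegment L (u :: l)).tail) :
    G.probability (fun L => π.PicksFrom L u (liveSegment L (u :: l))) ≤
      2 - 2 * G.expect fun L => missProb (G.seedProb π) (liveSegment L (u :: l)) := by
  have e : G.expect (fun L => missProb (G.seedProb π) (liveSegment L (u :: l))) =
      Real.exp (-G.seedProb π u) *
        G.expect fun L => missProb (G.seedProb π) (liveSegment L (u :: l)).tail := by
    rw [← expect_const_mul]
    refine G.expect_congr fun L _ => ?_
    rw [← missProb_cons, ← liveSegment_cons]
  rw [e]
  refine le_two_sub_two_mul (G.seedProb_nonneg π u)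
    (G.probability_le_one _) (G.probability_le_one _) ?_ h
  refine le_trans (G.probability_mono fun L _ hL => ?_) (G.probability_or_le _ _)
  rw [liveSegment_cons] at hL
  exact hL.of_cons π

/-- Along a path, independent random seeds with the selection rates of an adaptive policy are at
least half as good as the policy. -/
theorem probability_picksFrom_tail_le {u : V} {l : List V}
    (hl : ∀ e ∈ chainEdges (u :: l), e ∈ G.edges) (hn : (u :: l).Nodup) :
    G.probability (fun L => π.PicksFrom L u (liveSegment L (u :: l)).tail) ≤
      2 - 2 * G.expect fun L => missProb (G.seedProb π) (liveSegment L (u :: l)).tail := by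
  classical
  induction l generalizing u with
  | nil =>
    simp only [liveSegment, List.tail_cons, missProb_nil, expect_const]
    have : ∀ L ⊆ G.edges, (if π.PicksFrom L u [] then (1 : ℝ) else 0) = 0 := by
      intro L _
      simp [AdaptivePolicy.PicksFrom]
    rw [probability, G.expect_congr this, expect_const]
    norm_num
  | cons w l ih =>
    have hwu : (w, u) ∈ G.edges := hl _ (by simp [chainEdges])
    have hu : u ∉ w :: l := (List.nodup_cons.1 hn).1
    have hne : w ≠ u := fun h => hu (by simp [h])
    have ih := G.probability_picksFrom_cons_le π
      (ih (fun e he => hl e (by simp [chainEdges, he])) (List.nodup_cons.1 hn).2)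
    have hseg : ∀ L : Finset (V × V),
        liveSegment L (w :: l) = liveSegment (L \ {(w, u)}) (w :: l) := fun L => by
      refine liveSegment_congr fun e he => ?_
      have : e ≠ (w, u) := by
        rintro rfl
        exact hu (mem_of_mem_chainEdges he).2
      simp [this]
    have e1 : G.expect (fun L => missProb (G.seedProb π) (liveSegment L (u :: w :: l)).tail) =
        1 - G.prob w u + G.prob w u *
          G.expect fun L => missProb (G.seedProb π) (liveSegment L (w :: l)) := by
      rw [← G.expect_gate hwu (fun L _ => by rw [hseg])]
      refine G.expect_congr fun L _ => ?_
      rw [liveSegment, List.tail_cons]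
      split_ifs
      · rfl
      · exact missProb_nil _
    -- If the edge `(w, u)` is dead the tail is empty. If it is live, `w` is inactive whenever `u`
    -- is, and the event for `w` does not depend on this edge, which leaves `w`; so the factor
    -- `G.prob w u` splits off.
    have e2 : G.probability (fun L => π.PicksFrom L u (liveSegment L (u :: w :: l)).tail) ≤
        G.prob w u * G.probability (fun L => π.PicksFrom L w (liveSegment L (w :: l))) := by
      rw [← G.probability_mem hwu, ← G.probability_and_of_indep {(w, u)}]
      · refine G.probability_mono fun L _ hL => ?_
        rw [liveSegment, List.tail_cons] at hL
        split_ifs at hL with h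
        · exact ⟨h, hL.of_mem π h⟩
        · obtain ⟨_, _, v, hv, _⟩ := hL
          simp at hv
      · simp
      · intro L _
        rw [← hseg]
        constructor <;> intro h <;> refine h.of_agree π fun e he => ?_ <;>
          · have : e ≠ (w, u) := fun h => he (by rw [h])
            simp [this]
    have hp := (G.prob_mem_of_mem_edges hwu).1
    have := mul_le_mul_of_nonneg_left ih hp
    rw [e1]
    simp only at this
    linarith

end InfluenceGraph

end PathBound

/-! ### Both arms together: the factor 3 at a single node. -/

section NodeBound

variable {V : Type u}

theorem SimpleGraph.reachable_of_reaches {H : SimpleGraph V} {L : Finset (V × V)}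
    (hL : ∀ e ∈ L, H.Adj e.1 e.2) {v m : V} (h : Reaches L v m) : H.Reachable m v := by
  induction h with
  | refl => exact .refl _
  | tail _ hbc ih => exact (hL _ hbc).symm.reachable.trans ih

/-- If two lists have no common element, then a set covering both is missed with at most the product
of the probabilities. -/
theorem exp_neg_sum_le_missProb_mul {x : V → ℝ} (hx : ∀ v, 0 ≤ x v) {p q : List V}
    (hp : p.Nodup) (hq : q.Nodup) (hpq : p.Disjoint q) {S : Finset V} (hpS : ∀ v ∈ p, v ∈ S)
    (hqS : ∀ v ∈ q, v ∈ S) :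
    Real.exp (-∑ v ∈ S, x v) ≤ missProb x p * missProb x q := by
  classical
  rw [missProb, missProb, ← Real.exp_add, Real.exp_le_exp, ← neg_add, neg_le_neg_iff,
    ← List.sum_append, ← List.map_append, ← List.sum_toFinset x (hp.append hq hpq)]
  refine Finset.sum_le_sum_of_subset_of_nonneg (fun v hv => ?_) fun v _ _ => hx v
  rw [List.mem_toFinset, List.mem_append] at hv
  exact hv.elim (hpS v) (hqS v)

variable [Fintype V]

open Classical in
/-- The nodes from which `m` can be reached along live edges. -/
noncomputable def coreach (L : Finset (V × V)) (m : V) : Finset V :=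
  Finset.univ.filter fun v => Reaches L v m

theorem mem_coreach {L : Finset (V × V)} {v m : V} : v ∈ coreach L m ↔ Reaches L v m := by
  simp [coreach]

theorem exp_neg_two_le : Real.exp (-2) ≤ 1 / 7 := by
  have h := Real.exp_one_gt_d9
  rw [Real.exp_neg, show (2 : ℝ) = 1 + 1 by norm_num, Real.exp_add, inv_eq_one_div]
  exact one_div_le_one_div_of_le (by norm_num) (by nlinarith)

/-- A linear lower bound for `1 - exp (-t)` on `[0, 2]`. -/
theorem mul_le_one_sub_exp_neg {t : ℝ} (h0 : 0 ≤ t) (h2 : t ≤ 2) :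
    3 / 7 * t ≤ 1 - Real.exp (-t) := by
  have h := convexOn_exp.2 (Set.mem_univ (-2)) (Set.mem_univ 0) 
    (show 0 ≤ t / 2 by linarith) (show 0 ≤ 1 - t / 2 by linarith) (by ring)
  simp only [smul_eq_mul, Real.exp_zero] at h
  rw [show t / 2 * (-2) + (1 - t / 2) * 0 = -t by ring] at h
  nlinarith [exp_neg_two_le]

/-- The product (1 - a/2)(1 - b/2) is at most (1 - s/4)² for s = a + b. The constant 7/16 is 1 -
(3/4)², attained at s = 1. -/
theorem two_arms_bound {r a b A B : ℝ} (hr : r ≤ 1) (hrab : r ≤ a + b)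
    (ha : 0 ≤ a) (hb : 0 ≤ b) (ha1 : a ≤ 1) (hb1 : b ≤ 1) (hB0 : 0 ≤ B)
    (hA : a ≤ 2 - 2 * A) (hB : b ≤ 2 - 2 * B) : A * B ≤ 1 - 7 / 16 * r := by
  have h1 : A * B ≤ (1 - a / 2) * (1 - b / 2) :=
    mul_le_mul (by linarith) (by linarith) hB0 (by linarith)
  rcases le_total (a + b) 1 with h | h
  · nlinarith [sq_nonneg (a - b)]
  · nlinarith [sq_nonneg (a - b)]

namespace InfluenceGraph

variable (G : InfluenceGraph V) (π : AdaptivePolicy V)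

/-- Both arms start at `m`; the tail on the right keeps `m` from being counted twice. -/
theorem probability_activated_le_two_arms {m : V} {p q : List V}
    (hpq : ∀ L ⊆ G.edges, ∀ v, Reaches L v m →
      v ∈ liveSegment L (m :: p) ∨ v ∈ liveSegment L (m :: q)) :
    G.probability (fun L => m ∈ (π.run L).activated) ≤
      G.probability (fun L => π.PicksFrom L m (liveSegment L (m :: p))) +
        G.probability (fun L => π.PicksFrom L m (liveSegment L (m :: q)).tail) := by
  refine le_trans (G.probability_mono fun L hL h => ?_) (G.probability_or_le _ _)
  obtain ⟨i, hi, v, hpick, hm, hv⟩ := π.exists_picks_of_mem_activated L h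
  rcases hpq L hL v hv with h | h
  · exact .inl ⟨i, hi, v, h, hpick, hm⟩
  · rw [liveSegment_cons, List.mem_cons] at h
    rcases h with rfl | h
    · exact .inl ⟨i, hi, v, by rw [liveSegment_cons]; simp, hpick, hm⟩
    · exact .inr ⟨i, hi, v, h, hpick, hm⟩

theorem expect_missProb_mul {m : V} {p q : List V}
    (hd : (chainEdges (m :: p)).Disjoint (chainEdges (m :: q))) (x : V → ℝ) :
    G.expect (fun L => missProb x (liveSegment L (m :: p)) *
        missProb x (liveSegment L (m :: q)).tail) =
      G.expect (fun L => missProb x (liveSegment L (m :: p))) *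
        G.expect (fun L => missProb x (liveSegment L (m :: q)).tail) := by
  classical
  refine G.expect_mul_of_indep (chainEdges (m :: p)).toFinset (fun L _ => ?_) fun L _ => ?_
  · rw [liveSegment_congr (L' := L ∩ (chainEdges (m :: p)).toFinset)]
    intro e he
    simp [he]
  · rw [liveSegment_congr (L' := L \ (chainEdges (m :: p)).toFinset)]
    intro e he
    have : e ∉ chainEdges (m :: p) := fun h => hd h he
    simp [this]

theorem expect_mul_sum_coreach (x : V → ℝ) (m : V) :
    G.expect (fun L => ∑ v ∈ coreach L m, x v) =
      ∑ v, x v * G.probability fun L => Reaches L v m := by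
  classical
  unfold probability
  simp_rw [← expect_const_mul]
  rw [← expect_sum]
  refine G.expect_congr fun L _ => ?_
  simp [coreach, Finset.sum_filter]

/-- In a graph whose components are paths and cycles, independent random seeds with the selection
rates of an adaptive policy activate every node with at least a third of the probability that
the policy does. -/
theorem probability_activated_le_three_mul {H : SimpleGraph V} (hGH : ∀ u v, G.Adj u v ↔ H.Adj u v)
    (hH : H.AtMostTwoNeighbors) (m : V) :
    G.probability (fun L => m ∈ (π.run L).activated) ≤
      3 * G.expect fun L => 1 - Real.exp (-∑ v ∈ coreach L m, G.seedProb π v) := by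
  classical
  set x := G.seedProb π
  have hx : ∀ v, 0 ≤ x v := G.seedProb_nonneg π
  have hadj : ∀ e, e ∈ G.edges ↔ H.Adj e.1 e.2 := fun e => by
    simp only [edges, Finset.mem_filter, Finset.mem_univ, true_and]
    exact hGH _ _
  set C := Finset.univ.filter fun v => H.Reachable m v
  have hsub : ∀ L ⊆ G.edges, coreach L m ⊆ C := fun L hL v hv => by
    simpa [C] using SimpleGraph.reachable_of_reaches (fun e he => (hadj e).1 (hL he))
      (mem_coreach.1 hv)
  set ρ := G.expect fun L => 1 - Real.exp (-∑ v ∈ coreach L m, x v) with hρ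
  have hnn : ∀ L : Finset (V × V), 0 ≤ ∑ v ∈ coreach L m, x v := fun L =>
    Finset.sum_nonneg fun v _ => hx v
  have hρ0 : 0 ≤ ρ := by
    refine G.expect_nonneg fun L _ => ?_
    have := Real.exp_le_one_iff.2 (neg_nonpos.2 (hnn L))
    linarith
  rcases le_total (∑ v ∈ C, x v) 2 with hK | hK
  -- A light component: the union bound gives the factor 7/3.
  · have h1 := G.probability_activated_le π m
    rw [← G.expect_mul_sum_coreach (G.seedProb π) m] at h1
    have h2 : 3 / 7 * G.expect (fun L => ∑ v ∈ coreach L m, x v) ≤ ρ := by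
      rw [← expect_const_mul]
      refine G.expect_mono fun L hL => mul_le_one_sub_exp_neg (hnn L) (le_trans ?_ hK)
      exact Finset.sum_le_sum_of_subset_of_nonneg (hsub L hL) fun v _ _ => hx v
    linarith
  · obtain ⟨p, q, F, hcov⟩ := exists_fork hH m
    have hedge : ∀ l : List V, l.IsChain H.Adj → ∀ e ∈ chainEdges l, e ∈ G.edges := by
      intro l hl e he
      obtain ⟨i, hi, rfl⟩ := mem_chainEdges.1 he
      exact (hadj _).2 (List.isChain_iff_getElem.1 hl i hi).symm
    have hp := G.probability_picksFrom_cons_le π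
      (G.probability_picksFrom_tail_le π (hedge _ F.chain_left) F.nodup_left)
    have hq := G.probability_picksFrom_tail_le π (hedge _ F.chain_right) F.nodup_right
    have hr := G.probability_activated_le_two_arms π (m := m) (p := p) (q := q)
      fun L hL v hv => hcov L v (fun e he => (hadj e).1 (hL he)) hv
    have hAB := two_arms_bound (G.probability_le_one _) hr (G.probability_nonneg _)
      (G.probability_nonneg _) (G.probability_le_one _) (G.probability_le_one _)
      (G.expect_nonneg fun _ _ => missProb_nonneg _ _) hp hq
    rw [← G.expect_missProb_mul (F.disjoint_chainEdges hH)] at hAB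
    set O := G.probability fun L => C ⊆ coreach L m with hO
    have hexpK : Real.exp (-∑ v ∈ C, x v) ≤ 1 / 7 :=
      (Real.exp_le_exp.2 (by linarith)).trans exp_neg_two_le
    -- `O` is the probability that the whole component reaches `m`; the Poisson seeds then hit it
    -- with probability at least 1 - exp(-2) ≥ 6/7.
    have hOρ : 6 / 7 * O ≤ ρ := by
      rw [hO, probability, ← expect_const_mul]
      refine G.expect_mono fun L hL => ?_
      have h1 := Real.exp_le_one_iff.2 (neg_nonpos.2 (hnn L))
      split_ifs with h
      · rw [(hsub L hL).antisymm h]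
        linarith
      · linarith
    have hmiss : 1 - ρ ≤ G.expect (fun L => missProb x (liveSegment L (m :: p)) *
        missProb x (liveSegment L (m :: q)).tail) + 1 / 7 * O := by
      have hρ' : 1 - ρ = G.expect fun L => Real.exp (-∑ v ∈ coreach L m, x v) := by
        rw [hρ, expect_sub, expect_const]; ring
      rw [hρ', hO, probability, ← expect_const_mul, ← expect_add]
      refine G.expect_mono fun L hL => ?_
      have hpos : 0 ≤ missProb x (liveSegment L (m :: p)) *
        missProb x (liveSegment L (m :: q)).tail :=
          mul_nonneg (missProb_nonneg _ _) (missProb_nonneg _ _)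
      have F' := F.of_isPrefix (liveSegment_isPrefix L _) (liveSegment_isPrefix L _)
      have hpS : ∀ v ∈ liveSegment L (m :: p), v ∈ coreach L m := fun v hv =>
        mem_coreach.2 (reaches_of_mem_liveSegment hv)
      have hqS : ∀ v ∈ liveSegment L (m :: q), v ∈ coreach L m := fun v hv =>
        mem_coreach.2 (reaches_of_mem_liveSegment hv)
      by_cases hdis : (liveSegment L (m :: p)).Disjoint (liveSegment L (m :: q)).tail
      · have := exp_neg_sum_le_missProb_mul hx F'.nodup_left F'.nodup_right.tail hdis hpS
          fun v hv => hqS v (List.mem_of_mem_tail hv)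
        split_ifs <;> linarith
      -- Overlapping segments count nodes twice, so the product may be too small as a bound. But
      -- then they cover the component, and the error is at most exp(-x(C)) ≤ 1/7.
      · have hC : C ⊆ coreach L m := by
          simp only [List.Disjoint, not_forall] at hdis
          obtain ⟨v, hv, hv', -⟩ := hdis
          intro y hy
          have hy : H.Reachable m y := by simpa [C] using hy
          rw [liveSegment_cons L m p, liveSegment_cons L m q] at F'
          have hvm : v ≠ m := by
            rintro rfl
            exact (List.nodup_cons.1 F'.nodup_right).1 hv'
          rw [liveSegment_cons, List.mem_cons, or_iff_right hvm] at hv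
          rcases F'.cover hH hv hv' hy with h | h
          · rw [← liveSegment_cons] at h; exact hpS y h
          · rw [← liveSegment_cons] at h; exact hqS y h
        rw [if_pos hC, (hsub L hL).antisymm hC]
        linarith
    -- With r the activation probability, 1 - ρ ≤ 1 - 7r/16 + O/7 and O ≤ 7ρ/6 give r ≤ 8ρ/3.
    linarith

/-! ### From single nodes to the two optima. -/

theorem spread_mono {S T : Finset V} (h : S ⊆ T) : G.spread S ≤ G.spread T := by
  refine G.expect_mono fun L _ => ?_
  norm_cast
  refine Finset.card_le_card fun v hv => ?_
  rw [mem_reach] at hv ⊢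
  obtain ⟨u, hu, huv⟩ := hv
  exact ⟨u, h hu, huv⟩

theorem spread_nonneg (S : Finset V) : 0 ≤ G.spread S := by
  rw [spread_eq]
  exact Finset.sum_nonneg fun _ _ => G.probability_nonneg _

theorem spread_le_optN {S : Finset V} {k : ℕ} (hS : S.card ≤ k) (hk : k ≤ Fintype.card V) :
    G.spread S ≤ G.optN k := by
  obtain ⟨T, hST, hT⟩ := Finset.exists_superset_card_eq hS hk
  exact (G.spread_mono hST).trans (le_csSup (Set.toFinite _).bddAbove ⟨T, hT, rfl⟩)

theorem optN_nonneg (k : ℕ) : 0 ≤ G.optN k := by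
  refine Real.sSup_nonneg ?_
  rintro _ ⟨S, _, rfl⟩
  exact G.spread_nonneg S

theorem probability_compl (P : Finset (V × V) → Prop) :
    G.probability P = G.expect fun L => 1 - (open Classical in if ¬ P L then 1 else 0) := by
  refine G.expect_congr fun L _ => ?_
  by_cases h : P L <;> simp [h]

/-- Drawing `k` seeds independently with probabilities proportional to `x` bounds the non-adaptive
optimum from below. -/
theorem sum_expect_le_optN {x : V → ℝ} (hx : ∀ v, 0 ≤ x v) {k : ℕ} (hk0 : 0 < k)
    (hsum : ∑ v, x v = k) (hk : k ≤ Fintype.card V) :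
    ∑ m, G.expect (fun L => 1 - Real.exp (-∑ v ∈ coreach L m, x v)) ≤ G.optN k := by
  classical
  have hk' : (0 : ℝ) < k := by exact_mod_cast hk0
  set w : (Fin k → V) → ℝ := fun f => ∏ i, x (f i) / k with hw
  have hw0 : ∀ f, 0 ≤ w f := fun f => Finset.prod_nonneg fun i _ => div_nonneg (hx _) hk'.le
  have hw1 : ∑ f, w f = 1 := by
    rw [hw, ← Fintype.sum_pow (fun v => x v / k) k, ← Finset.sum_div, hsum, div_self hk'.ne',
      one_pow]
  -- Repeated draws may give fewer than `k` seeds; by monotonicity the optimum over exactly `k`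
  -- still dominates.
  have hle : ∑ f, w f * G.spread (Finset.univ.image f) ≤ G.optN k := by
    calc _ ≤ ∑ f, w f * G.optN k := Finset.sum_le_sum fun f _ =>
          mul_le_mul_of_nonneg_left (G.spread_le_optN
            (Finset.card_image_le.trans (by simp)) hk) (hw0 f)
      _ = _ := by rw [← Finset.sum_mul, hw1, one_mul]
  refine le_trans ?_ hle
  simp_rw [spread_eq, Finset.mul_sum]
  rw [Finset.sum_comm]
  refine Finset.sum_le_sum fun m _ => ?_
  simp_rw [probability_compl, ← expect_const_mul]
  rw [← expect_sum]
  refine G.expect_mono fun L _ => ?_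
  simp_rw [mul_sub, mul_one]
  rw [Finset.sum_sub_distrib, hw1, sub_le_sub_iff_left]
  set S := coreach L m
  have hS : ∑ v ∈ S, x v ≤ k := by
    rw [← hsum]
    exact Finset.sum_le_sum_of_subset_of_nonneg (Finset.subset_univ _) fun v _ _ => hx v
  -- The probability that all `k` draws avoid `S`, as the power of the probability for one draw.
  refine le_trans (le_of_eq (b := (∑ v, if v ∈ S then 0 else x v / k) ^ k) ?_) ?_
  · rw [Fintype.sum_pow]
    refine Finset.sum_congr rfl fun f _ => ?_
    have hm : m ∈ reach (Finset.univ.image f) L ↔ ∃ i, f i ∈ S := by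
      simp [mem_reach, S, mem_coreach]
    by_cases h : ∃ i, f i ∈ S
    · obtain ⟨i, hi⟩ := h
      rw [if_neg (not_not.2 (hm.2 ⟨i, hi⟩)), mul_zero]
      exact (Finset.prod_eq_zero (Finset.mem_univ i) (by simp [hi])).symm
    · rw [if_pos (fun h' => h (hm.1 h')), mul_one]
      refine Finset.prod_congr rfl fun i _ => ?_
      rw [if_neg fun hi => h ⟨i, hi⟩]
  · have e2 : (∑ v, if v ∈ S then 0 else x v / k) = 1 - (∑ v ∈ S, x v) / k := by
      have : ∀ v, (if v ∈ S then 0 else x v / (k : ℝ)) =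
          x v / k - if v ∈ S then x v / k else 0 := fun v => by split_ifs <;> simp
      simp_rw [this]
      rw [Finset.sum_sub_distrib, ← Finset.sum_div, hsum, div_self hk'.ne', Finset.sum_ite_mem,
        Finset.univ_inter, Finset.sum_div]
    rw [e2]
    exact Real.one_sub_div_pow_le_exp_neg hS

theorem optA_le_mul_optN {c : ℝ} (hc : 0 ≤ c) {k : ℕ}
    (h : ∀ π, G.PolicySize π k → G.policySpread π ≤ c * G.optN k) :
    G.optA k ≤ c * G.optN k := by
  refine Real.sSup_le ?_ (mul_nonneg hc (G.optN_nonneg k))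
  rintro _ ⟨π, hπ, rfl⟩
  exact h π hπ

theorem policySpread_le_card_mul {k : ℕ} (hk0 : 0 < k) (hk : k ≤ Fintype.card V)
    (hπ : G.PolicySize π k) : G.policySpread π ≤ k * G.optN k := by
  rw [policySpread_eq, ← G.sum_seedProb π hπ, Finset.sum_mul]
  refine (Finset.sum_le_sum fun m _ => G.probability_activated_le π m).trans ?_
  rw [Finset.sum_comm]
  refine Finset.sum_le_sum fun v _ => ?_
  rw [← Finset.mul_sum]
  refine mul_le_mul_of_nonneg_left ?_ (G.seedProb_nonneg π v)
  have := G.spread_le_optN (S := {v}) (k := k) (by rw [Finset.card_singleton]; exact hk0) hk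
  rw [spread_eq] at this
  simpa only [mem_reach_singleton] using this

theorem IsBounded.exists_simpleGraph (h : G.IsBounded 0) :
    ∃ H : SimpleGraph V, (∀ u v, G.Adj u v ↔ H.Adj u v) ∧ H.AtMostTwoNeighbors := by
  classical
  obtain ⟨H, hGH, hdeg⟩ := h
  refine ⟨H, hGH, fun y a b z ha hb hz haz hbz => ?_⟩
  by_contra hab
  have h3 : 2 < H.degree y := by
    rw [← H.card_neighborFinset_eq_degree]
    calc 2 < ({a, b, z} : Finset V).card := by
          rw [Finset.card_eq_three.2 ⟨a, b, z, hab, haz, hbz, rfl⟩]; norm_num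
      _ ≤ _ := Finset.card_le_card fun v hv => by
          simp only [Finset.mem_insert, Finset.mem_singleton] at hv
          rw [H.mem_neighborFinset]
          rcases hv with rfl | rfl | rfl <;> assumption
  have h0 := Finset.sum_eq_zero_iff.1 (Nat.le_zero.1 hdeg) y
    (by simp only [Finset.mem_filter, Finset.mem_univ, true_and]; convert h3)
  have : H.degree y = 0 := by convert h0
  omega

theorem policySpread_le_three_mul (h : G.IsBounded 0) {k : ℕ} (hk0 : 0 < k)
    (hk : k ≤ Fintype.card V) (hπ : G.PolicySize π k) : G.policySpread π ≤ 3 * G.optN k := by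
  obtain ⟨H, hGH, hH⟩ := h.exists_simpleGraph
  rw [policySpread_eq]
  calc _ ≤ ∑ m, 3 * G.expect (fun L => 1 - Real.exp (-∑ v ∈ coreach L m, G.seedProb π v)) :=
        Finset.sum_le_sum fun m _ => G.probability_activated_le_three_mul π hGH hH m
    _ ≤ _ := by
        rw [← Finset.mul_sum]
        exact mul_le_mul_of_nonneg_left (G.sum_expect_le_optN (G.seedProb_nonneg π) hk0
          (G.sum_seedProb π hπ) hk) (by norm_num)

end InfluenceGraph

end NodeBound

/-! ### Numerical estimates and the theorem. -/

theorem three_div_one_sub_exp : 3 / (1 - Real.exp (-3)) = 3 * Real.exp 3 / (Real.exp 3 - 1) := by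
  have h : 1 < Real.exp 3 := Real.one_lt_exp_iff.2 (by norm_num)
  rw [Real.exp_neg, div_eq_div_iff]
  · field_simp
  · have := inv_lt_one_of_one_lt₀ h
    linarith
  · linarith

theorem max_one_sub_pow_le {k : ℕ} (hk : 0 < k) :
    (max 0 (1 - 3 / (k : ℝ))) ^ k ≤ Real.exp (-3) := by
  rcases le_total (3 : ℝ) k with h | h
  · have : 3 / (k : ℝ) ≤ 1 := div_le_one_of_le₀ h (by positivity)
    rw [max_eq_right (by linarith)]
    exact Real.one_sub_div_pow_le_exp_neg h
  · have : 1 ≤ 3 / (k : ℝ) := (one_le_div (by exact_mod_cast hk)).2 h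
    rw [max_eq_left (by linarith), zero_pow hk.ne']
    exact Real.exp_nonneg _

theorem theorem5p2 (k : ℕ) (hk : 2 ≤ k) :
    adaptivityGap.{u} (fun V _ => boundedClass 0 V) k ≤
        ((min (k : ℝ) (3 / (1 - (max 0 (1 - 3 / (k : ℝ))) ^ k)) : ℝ) : EReal) ∧
      min (k : ℝ) (3 / (1 - (max 0 (1 - 3 / (k : ℝ))) ^ k)) ≤
        3 * Real.exp 3 / (Real.exp 3 - 1) ∧
      |3 * Real.exp 3 / (Real.exp 3 - 1) - 3.16| < 0.005 := by
  have hk0 : 0 < k := by omega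
  have hexp3 : Real.exp (-3) < 1 := by rw [Real.exp_lt_one_iff]; norm_num
  have hq := max_one_sub_pow_le hk0
  have hq0 : 0 ≤ (max 0 (1 - 3 / (k : ℝ))) ^ k := pow_nonneg (le_max_left _ _) _
  set q := (max 0 (1 - 3 / (k : ℝ))) ^ k
  refine ⟨?_, ?_, ?_⟩
  · refine iSup_le fun V => iSup_le fun _ => iSup_le fun G => iSup_le fun hG => iSup_le fun hV => ?_
    rw [EReal.coe_le_coe_iff, le_min_iff]
    constructor
    · exact div_le_of_le_mul₀ (G.optN_nonneg k) (by positivity)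
        (G.optA_le_mul_optN (by positivity) fun π hπ => G.policySpread_le_card_mul π hk0 hV hπ)
    -- The ratio is at most 3, which is stronger than needed because 0 ≤ `q` < 1.
    · refine (div_le_of_le_mul₀ (G.optN_nonneg k) (by positivity)
        (G.optA_le_mul_optN (c := 3) (by positivity) fun π hπ =>
          G.policySpread_le_three_mul π hG hk0 hV hπ)).trans ?_
      rw [le_div_iff₀ (by linarith)]
      linarith
  · refine (min_le_right _ _).trans ?_
    rw [← three_div_one_sub_exp]
    exact div_le_div_of_nonneg_left (by norm_num) (by linarith) (by linarith)
  · have h1 := Real.exp_one_gt_d9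
    have h2 := Real.exp_one_lt_d9
    have h3 : Real.exp 3 = Real.exp 1 ^ 3 := by rw [← Real.exp_nat_mul]; norm_num
    have hl : 20 < Real.exp 3 := by
      rw [h3]
      calc (20 : ℝ) < 2.718 ^ 3 := by norm_num
        _ ≤ _ := by gcongr; linarith
    have hu : Real.exp 3 < 20.2 := by
      rw [h3]
      calc Real.exp 1 ^ 3 ≤ 2.72 ^ 3 := by gcongr; linarith
        _ < 20.2 := by norm_num
    have : 3 * Real.exp 3 / (Real.exp 3 - 1) = 3 + 3 / (Real.exp 3 - 1) := by
      field_simp [show Real.exp 3 - 1 ≠ 0 by linarith]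
      ring
    rw [this, abs_lt]
    constructor
    · have : 0.155 < 3 / (Real.exp 3 - 1) := by
        rw [lt_div_iff₀ (by linarith)]; linarith
      linarith
    · have : 3 / (Real.exp 3 - 1) < 0.165 := by
        rw [div_lt_iff₀ (by linarith)]; linarith
      linarith
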